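/- Let $(T,\Sigma,\mu)$ be a finite measure space (of agents), $(\Omega,\mathscr F)$ a measurable space (of states of nature), and $\ell\in\mathbb N$. Order $\mathbb R^\ell$ coordinate-wise, write $y>0$ if $y\ge 0$ and $y\ne 0$, and $y\gg 0$ if all coordinates of $y$ are positive. Let $a:T\times\Omega\to\mathbb R^\ell_+$ and $U:T\times\Omega\times\mathbb R^\ell_+\to\mathbb R$ be functions (initial endowments and utilities) such that (A1) $a$ is jointly measurable and, for each $\omega\in\Omega$, $a(\cdot,\omega)$ is $\mu$-integrable with $\int_T a(\cdot,\omega)\,d\mu\gg 0$; (A2) $U(\cdot,\cdot,x)$ is jointly measurable for every $x\in\mathbb R^\ell_+$, and $U(t,\omega,\cdot)$ is continuous on $\mathbb R^\ell_+$ for every $(t,\omega)\in T\times\Omega$; (A3) $U(t,\omega,x+y)>U(t,\omega,x)$ for all $(t,\omega)\in T\times\Omega$ and all $x,y\in\mathbb R^\ell_+$ with $y>0$. Let $\Delta=\{p\in\mathbb R^\ell_+: p\gg 0,\ \sum_{h=1}^\ell p^h=1\}$. For $(t,\omega,p)\in T\times\Omega\times\Delta$ put $$B(t,\omega,p)=\{x\in\mathbb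 R^\ell_+:\langle p,x\rangle\le\langle p,a(t,\omega)\rangle\},$$ $$X(t,\omega,p)=\Big\{x\in\mathbb R^\ell_+:\ x^i\le \frac{1}{\min_{h}p^h}\sum_{h=1}^\ell a^h(t,\omega)\ \text{ for } i=1,\dots,\ell\Big\},$$ $$C(t,\omega,p)=\{y\in\mathbb R^\ell_+: U(t,\omega,y)\ge U(t,\omega,x)\ \text{ for all } x\in B(t,\omega,p)\},$$ $$C^X(t,\omega,p)=C(t,\omega,p)\cap X(t,\omega,p).$$ Then for every $(\omega,p)\in\Omega\times\Delta$ the aggregate preferred set, i.e. the Aumann integral $$\int_T C^X(\cdot,\omega,p)\,d\mu=\Big\{\int_T f\,d\mu:\ f:T\to\mathbb R^\ell\ \text{ is } \mu\text{-integrable and } f(t)\in C^X(t,\omega,p)\ \text{ for } \mu\text{-almost every } t\in T\Big\},$$ is non-empty and compact. -/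

import Mathlib

open MeasureTheory

noncomputable section

namespace ExchangeEconomy

/-- The positive cone `ℝ^ℓ_+`, the consumption set. The space `Fin ℓ → ℝ` carries the
coordinate-wise order, the usual topology of `ℝ^ℓ` and its Borel σ-algebra. -/
def orthant (ℓ : ℕ) : Set (Fin ℓ → ℝ) := {x | 0 ≤ x}

/-- The (open) price simplex: strictly positive vectors whose coordinates sum to one. -/
def priceSimplex (ℓ : ℕ) : Set (Fin ℓ → ℝ) := {p | (∀ h, 0 < p h) ∧ ∑ h, p h = 1}

/-- The Aumann integral of a correspondence `F` from `T` to `ℝ^ℓ`: the set of the integrals of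
all integrable functions `f` with `f t ∈ F t` for almost every `t`. -/
def aumannIntegral {T : Type*} [MeasurableSpace T] {ℓ : ℕ} (μ : Measure T)
    (F : T → Set (Fin ℓ → ℝ)) : Set (Fin ℓ → ℝ) :=
  {y | ∃ f : T → Fin ℓ → ℝ, Integrable f μ ∧ (∀ᵐ t ∂μ, f t ∈ F t) ∧ y = ∫ t, f t ∂μ}

section Assumptions

variable {T Ω : Type*} [MeasurableSpace T] [MeasurableSpace Ω] {ℓ : ℕ}

/-- The endowment is a jointly measurable map to `ℝ^ℓ_+` such that, in each state, the aggregate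
endowment exists and is an interior point of `ℝ^ℓ_+`. -/
structure EndowmentAssumption (μ : Measure T) (a : T → Ω → Fin ℓ → ℝ) : Prop where
  mem_orthant : ∀ t ω, a t ω ∈ orthant ℓ
  measurable : Measurable (fun z : T × Ω => a z.1 z.2)
  integrable : ∀ ω, Integrable (fun t => a t ω) μ
  aggregate_pos : ∀ ω h, 0 < (∫ t, a t ω ∂μ) h

/-- The utility of each consumption bundle is jointly measurable in agent and state, and is
continuous in the bundle. Only the values of `U t ω` on `ℝ^ℓ_+` matter. -/
structure UtilityRegularity (U : T → Ω → (Fin ℓ → ℝ) → ℝ) : Prop where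
  measurable : ∀ x ∈ orthant ℓ, Measurable (fun z : T × Ω => U z.1 z.2 x)
  continuousOn : ∀ t ω, ContinuousOn (U t ω) (orthant ℓ)

/-- Monotonicity of the utility functions; `0 < y` means `0 ≤ y` and `y ≠ 0`. -/
def UtilityMonotone (U : T → Ω → (Fin ℓ → ℝ) → ℝ) : Prop :=
  ∀ t ω, ∀ x ∈ orthant ℓ, ∀ y ∈ orthant ℓ, 0 < y → U t ω x < U t ω (x + y)

end Assumptions

section Correspondences

variable {T Ω : Type*} {ℓ : ℕ}

/-- The budget set `B(t, ω, p)`. -/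
def budgetSet (a : T → Ω → Fin ℓ → ℝ) (t : T) (ω : Ω) (p : Fin ℓ → ℝ) : Set (Fin ℓ → ℝ) :=
  {x | x ∈ orthant ℓ ∧ p ⬝ᵥ x ≤ p ⬝ᵥ a t ω}

/-- The smallest price `δ(p) = min {p h}`. -/
def minPrice (p : Fin ℓ → ℝ) : ℝ := ⨅ h, p h

/-- The vector `b(t, ω, p)`, all of whose coordinates are `(1 / δ(p)) ∑ a^h(t, ω)`. -/
def upperBound (a : T → Ω → Fin ℓ → ℝ) (t : T) (ω : Ω) (p : Fin ℓ → ℝ) : Fin ℓ → ℝ :=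
  fun _ => 1 / minPrice p * ∑ h, a t ω h

/-- The truncation set `X(t, ω, p)`. -/
def truncationSet (a : T → Ω → Fin ℓ → ℝ) (t : T) (ω : Ω) (p : Fin ℓ → ℝ) :
    Set (Fin ℓ → ℝ) :=
  {x | x ∈ orthant ℓ ∧ x ≤ upperBound a t ω p}

/-- The set `C(t, ω, p)` of bundles at least as good as every bundle in the budget set. -/
def weaklyPreferredSet (a : T → Ω → Fin ℓ → ℝ) (U : T → Ω → (Fin ℓ → ℝ) → ℝ)
    (t : T) (ω : Ω) (p : Fin ℓ → ℝ) : Set (Fin ℓ → ℝ) :=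
  {y | y ∈ orthant ℓ ∧ ∀ x ∈ budgetSet a t ω p, U t ω x ≤ U t ω y}

/-- The preferred set `C^X(t, ω, p) = C(t, ω, p) ∩ X(t, ω, p)`. -/
def preferredSet (a : T → Ω → Fin ℓ → ℝ) (U : T → Ω → (Fin ℓ → ℝ) → ℝ)
    (t : T) (ω : Ω) (p : Fin ℓ → ℝ) : Set (Fin ℓ → ℝ) :=
  weaklyPreferredSet a U t ω p ∩ truncationSet a t ω p

/-- The aggregate preferred set `∫_T C^X(·, ω, p) dμ`. -/
def aggregatePreferredSet [MeasurableSpace T] (μ : Measure T) (a : T → Ω → Fin ℓ → ℝ)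
    (U : T → Ω → (Fin ℓ → ℝ) → ℝ) (ω : Ω) (p : Fin ℓ → ℝ) : Set (Fin ℓ → ℝ) :=
  aumannIntegral μ (fun t => preferredSet a U t ω p)

end Correspondences

end ExchangeEconomy

end

namespace ExchangeEconomy

/-! For fixed `ω` and `p`, the preferred sets are compact, depend measurably on the agent and are
bounded by an integrable function `b`, a multiple of the total endowment. The result is thus a case
of Aumann's theorem on integrals of such correspondences. Measurability is encoded by writing each
value as the zero set, in a ball of radius `b t`, of a nonnegative Carathéodory function. This form
is stable under taking maximizers (`exists_argmax`), which yields measurable selections and hence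
non-emptiness.

Integrals of selections are bounded by the integral of `b`, so compactness reduces to closedness. Up
to null sets, the space splits into countably many atoms and an atomless part. Measurable functions
are a.e. constant on an atom, so there a subsequence of selections converges a.e. and dominated
convergence applies. On the atomless part Lyapunov's theorem makes the integral convex. If a point
of its closure were missing, a nonzero functional would attain its supremum there. The point then
lies in the closure of the integral of the face maximizing that functional (`mem_closure_face`),
which has smaller dimension, and induction on dimension concludes. -/

/-- A measure is atomless if every measurable set of positive measure splits into two measurable
sets of positive measure. -/
def Atomless {T : Type*} [MeasurableSpace T] (μ : Measure T) : Prop :=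
  ∀ A, MeasurableSet A → 0 < μ A → ∃ B ⊆ A, MeasurableSet B ∧ 0 < μ B ∧ 0 < μ (A \ B)

/-! ### Lyapunov's convexity theorem. -/

section Lyapunov

variable {T : Type*} [MeasurableSpace T] {μ : Measure T}

theorem Atomless.exists_disjoint (hμ : Atomless μ) (n : ℕ) : ∀ {E : Set T}, MeasurableSet E →
    0 < μ E → ∃ A : Fin n → Set T, (∀ i, MeasurableSet (A i)) ∧ (∀ i, A i ⊆ E) ∧
      (∀ i, 0 < μ (A i)) ∧ ∀ i j, i ≠ j → Disjoint (A i) (A j) := by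
  induction n with
  | zero => intro E _ _; exact ⟨fun _ => ∅, fun i => i.elim0, fun i => i.elim0, fun i => i.elim0,
      fun i => i.elim0⟩
  | succ n ih =>
    intro E hE hpos
    obtain ⟨B, hBE, hB, hB0, hB1⟩ := hμ E hE hpos
    obtain ⟨A, hA, hAE, hA0, hAd⟩ := ih (hE.diff hB) hB1
    refine ⟨Fin.cons B A, ?_, ?_, ?_, ?_⟩
    · intro i; refine Fin.cases ?_ (fun i => ?_) i <;> simp [hB, hA]
    · intro i; refine Fin.cases ?_ (fun i => ?_) i
      · simpa using hBE
      · simpa using (hAE i).trans Set.sdiff_subset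
    · intro i; refine Fin.cases ?_ (fun i => ?_) i <;> simp [hB0, hA0]
    · have key : ∀ i, Disjoint B (A i) := fun i =>
        Set.disjoint_left.2 fun x hx hx' => (hAE i hx').2 hx
      intro i j
      refine Fin.cases ?_ (fun i => ?_) i <;> refine Fin.cases ?_ (fun j => ?_) j
      · simp
      · simp [key]
      · simp [(key i).symm]
      · intro hij; simpa using hAd i j (fun h => hij (by rw [h]))

/-- Densities with values in `[0, 1]` and prescribed moments. -/
def IsFractional {ι : Type*} (μ : Measure T) (h : ι → Lp ℝ 2 μ) (c : ι → ℝ) (g : Lp ℝ 2 μ) : Prop :=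
  (∀ᵐ t ∂μ, 0 ≤ g t ∧ g t ≤ 1) ∧ ∀ i, inner ℝ g (h i) = c i

/-- Turns the pointwise bounds into inequalities between continuous linear functionals, which makes
the constraint set weak-* closed. -/
theorem ae_mem_Icc_iff [IsFiniteMeasure μ] (g : Lp ℝ 2 μ) : (∀ᵐ t ∂μ, 0 ≤ g t ∧ g t ≤ 1) ↔
    ∀ A (hA : MeasurableSet A), 0 ≤ inner ℝ g (indicatorConstLp 2 hA (measure_ne_top μ A) (1 : ℝ)) ∧
      inner ℝ g (indicatorConstLp 2 hA (measure_ne_top μ A) (1 : ℝ)) ≤ μ.real A := by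
  have hg : Integrable g μ := (Lp.memLp g).integrable (by norm_num)
  have e : ∀ A (hA : MeasurableSet A),
      inner ℝ g (indicatorConstLp 2 hA (measure_ne_top μ A) (1 : ℝ)) = ∫ t in A, g t ∂μ := by
    intro A hA
    rw [real_inner_comm, L2.inner_indicatorConstLp_one]
  simp only [e]
  constructor
  · intro h A hA
    refine ⟨integral_nonneg_of_ae (ae_restrict_of_ae (h.mono fun t ht => ht.1)), ?_⟩
    have := integral_mono_ae (μ := μ.restrict A) hg.restrict (integrable_const (1 : ℝ))
      (ae_restrict_of_ae (h.mono fun t ht => ht.2))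
    simpa using this
  · intro h
    have h0 : 0 ≤ᵐ[μ] g := ae_nonneg_of_forall_setIntegral_nonneg hg fun s hs _ => (h s hs).1
    have h1 : 0 ≤ᵐ[μ] fun t => 1 - g t := by
      refine ae_nonneg_of_forall_setIntegral_nonneg ((integrable_const _).sub hg) fun s hs _ => ?_
      rw [integral_sub (integrable_const _) hg.restrict]
      have := (h s hs).2
      simp
      exact this
    filter_upwards [h0, h1] with t ht ht'
    exact ⟨ht, by simpa using ht'⟩

/-- By the Riesz isomorphism the set becomes a bounded weak-* closed subset of the dual, compact by
Banach–Alaoglu, so Krein–Milman gives an extreme point. Extremality is used only through symmetric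
perturbations. -/
theorem exists_extreme_fractional {ι : Type*} [IsFiniteMeasure μ] (h : ι → Lp ℝ 2 μ) (c : ι → ℝ)
    (hne : ∃ g, IsFractional μ h c g) :
    ∃ g, IsFractional μ h c g ∧ ∀ ψ, IsFractional μ h c (g + ψ) → IsFractional μ h c (g - ψ) →
      ψ = 0 := by
  let J : Lp ℝ 2 μ → WeakDual ℝ (Lp ℝ 2 μ) :=
    fun g => StrongDual.toWeakDual (InnerProductSpace.toDual ℝ (Lp ℝ 2 μ) g)
  have hJ : ∀ g x, J g x = inner ℝ g x := fun g x => InnerProductSpace.toDual_apply_apply ..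
  have hJs : ∀ φ, ∃ g, J g = φ := fun φ =>
    ⟨(InnerProductSpace.toDual ℝ (Lp ℝ 2 μ)).symm (WeakDual.toStrongDual φ), by simp [J]⟩
  let S : Set (WeakDual ℝ (Lp ℝ 2 μ)) := {φ | (∀ A (hA : MeasurableSet A),
    0 ≤ φ (indicatorConstLp 2 hA (measure_ne_top μ A) (1 : ℝ)) ∧
      φ (indicatorConstLp 2 hA (measure_ne_top μ A) (1 : ℝ)) ≤ μ.real A) ∧ ∀ i, φ (h i) = c i}
  have hS : ∀ g, J g ∈ S ↔ IsFractional μ h c g := by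
    intro g
    simp only [S, Set.mem_ofPred_eq, IsFractional, hJ, ae_mem_Icc_iff]
  have hclosed : IsClosed S := by
    have : S = (⋂ (A) (hA : MeasurableSet A),
        {φ | 0 ≤ φ (indicatorConstLp 2 hA (measure_ne_top μ A) (1 : ℝ))} ∩
        {φ | φ (indicatorConstLp 2 hA (measure_ne_top μ A) (1 : ℝ)) ≤ μ.real A}) ∩
        ⋂ i, {φ | φ (h i) = c i} := by
      ext φ; simp [S]
    rw [this]
    refine (isClosed_iInter fun A => isClosed_iInter fun hA => ?_).inter (isClosed_iInter fun i => ?_)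
    · exact (isClosed_le continuous_const (WeakDual.eval_continuous _)).inter
        (isClosed_le (WeakDual.eval_continuous _) continuous_const)
    · exact isClosed_eq (WeakDual.eval_continuous _) continuous_const
  have hcomp : IsCompact S := by
    refine (WeakDual.isCompact_closedBall (𝕜 := ℝ) (E := Lp ℝ 2 μ) 0
      ((measureUnivNNReal μ : ℝ) ^ ((2 : ENNReal).toReal)⁻¹ * 1)).of_isClosed_subset hclosed ?_
    intro φ hφ
    obtain ⟨g, rfl⟩ := hJs φ
    have hg := ((hS g).1 hφ).1
    have : ‖g‖ ≤ (measureUnivNNReal μ : ℝ) ^ ((2 : ENNReal).toReal)⁻¹ * 1 :=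
      Lp.norm_le_of_ae_bound zero_le_one (hg.mono fun t ht => by
        rw [Real.norm_eq_abs, abs_of_nonneg ht.1]; exact ht.2)
    simpa [J] using this
  obtain ⟨g₀, hg₀⟩ := hne
  have : LocallyConvexSpace ℝ (WeakDual ℝ (Lp ℝ 2 μ)) :=
    inferInstanceAs (LocallyConvexSpace ℝ (WeakBilin (topDualPairing ℝ (Lp ℝ 2 μ))))
  obtain ⟨φ, hφ⟩ := hcomp.extremePoints_nonempty ⟨J g₀, (hS g₀).2 hg₀⟩
  obtain ⟨g, rfl⟩ := hJs φ
  refine ⟨g, (hS g).1 hφ.1, fun ψ h1 h2 => ?_⟩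
  have h3 := hφ.2 ((hS _).2 h1) ((hS _).2 h2) (by
    refine ⟨1 / 2, 1 / 2, by norm_num, by norm_num, by norm_num, ?_⟩
    simp only [J, map_add, map_sub]
    module)
  have : ∀ x, inner ℝ ψ x = 0 := by
    intro x
    have := congrArg (fun f : WeakDual ℝ (Lp ℝ 2 μ) => f x) h3
    simp only [hJ, inner_add_left] at this
    linarith
  exact inner_self_eq_zero.1 (this ψ)

/-- More vectors than dimensions force a linear relation; rescaling makes its coefficients small
enough for a perturbation to respect the bounds of a density. -/
theorem exists_ne_zero_combination {N n : ℕ} (hn : n < N) (M : Fin N → Fin n → ℝ) {ε : ℝ}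
    (hε : 0 < ε) : ∃ α : Fin N → ℝ, (∀ i, ∑ j, α j * M j i = 0) ∧ (∃ j, α j ≠ 0) ∧ ∀ j, |α j| ≤ ε := by
  have : ¬ LinearIndependent ℝ M := fun h => by
    have := h.fintype_card_le_finrank
    simp at this
    omega
  obtain ⟨β, hβ, j₀, hj₀⟩ := Fintype.not_linearIndependent_iff.1 this
  have hs : 0 < ∑ j, |β j| := Finset.sum_pos' (fun _ _ => abs_nonneg _)
    ⟨j₀, Finset.mem_univ _, abs_pos.2 hj₀⟩
  refine ⟨fun j => ε / (∑ j, |β j|) * β j, fun i => ?_, ⟨j₀, by positivity⟩, fun j => ?_⟩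
  · have := congrFun hβ i
    simp only [Finset.sum_apply, Pi.smul_apply, smul_eq_mul, Pi.zero_apply] at this
    simp only [mul_assoc, ← Finset.mul_sum, this, mul_zero]
  · rw [abs_mul, abs_of_nonneg (by positivity), div_mul_eq_mul_div, div_le_iff₀ hs]
    exact mul_le_mul_of_nonneg_left
      (Finset.single_le_sum (f := fun j => |β j|) (fun _ _ => abs_nonneg _) (Finset.mem_univ j)) hε.le

/-- Lindenstrauss' argument: the constant `s` is a density with the required moments, and an extreme
density with these moments is the indicator of a set. -/
theorem lyapunov_L2 [IsFiniteMeasure μ] (hμ : Atomless μ) {n : ℕ} (h : Fin n → Lp ℝ 2 μ) {s : ℝ}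
    (hs0 : 0 ≤ s) (hs1 : s ≤ 1) :
    ∃ E, MeasurableSet E ∧ ∀ i, ∫ t in E, h i t ∂μ = s * ∫ t, h i t ∂μ := by
  set c : Fin n → ℝ := fun i => s * ∫ t, h i t ∂μ
  have ind : ∀ A (hA : MeasurableSet A) (f : Lp ℝ 2 μ),
      inner ℝ (indicatorConstLp 2 hA (measure_ne_top μ A) (1 : ℝ)) f = ∫ t in A, f t ∂μ := by
    intro A hA f
    rw [L2.inner_indicatorConstLp_one]
  obtain ⟨g, hg, hext⟩ := exists_extreme_fractional h c (by
    refine ⟨s • indicatorConstLp 2 MeasurableSet.univ (measure_ne_top μ _) (1 : ℝ), ?_, ?_⟩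
    · filter_upwards [Lp.coeFn_smul s (indicatorConstLp (μ := μ) 2 MeasurableSet.univ
        (measure_ne_top μ _) (1 : ℝ)), indicatorConstLp_coeFn (p := 2) (μ := μ)
        (hs := MeasurableSet.univ) (hμs := measure_ne_top μ _) (c := (1 : ℝ))] with t h1 h2
      rw [h1, Pi.smul_apply, h2]
      simp [hs0, hs1]
    · intro i
      rw [real_inner_smul_left, ind]
      simp [c])
  have hgs := Lp.stronglyMeasurable g
  -- If the density stayed `ε` away from 0 and 1 on a non-null set, `n + 1` disjoint pieces of that
  -- set would carry a nonzero step function `ψ` with `n` vanishing moments, bounded by `ε`. Both `g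
  -- + ψ` and `g - ψ` would then be admissible, against extremality.
  have key : ∀ ε : ℝ, 0 < ε → μ {t | ε ≤ g t ∧ g t ≤ 1 - ε} = 0 := by
    intro ε hε
    by_contra hne
    have hE : MeasurableSet {t | ε ≤ g t ∧ g t ≤ 1 - ε} :=
      (measurableSet_le measurable_const hgs.measurable).inter
        (measurableSet_le hgs.measurable measurable_const)
    obtain ⟨A, hA, hAE, hA0, hAd⟩ := hμ.exists_disjoint (n + 1) hE (pos_iff_ne_zero.2 hne)
    obtain ⟨α, hα, ⟨j₀, hj₀⟩, hαε⟩ := exists_ne_zero_combination (Nat.lt_succ_self n)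
      (fun j i => ∫ t in A j, h i t ∂μ) hε
    set ψ : Lp ℝ 2 μ := ∑ j, α j • indicatorConstLp 2 (hA j) (measure_ne_top μ _) (1 : ℝ) with hψ
    have hψc : ∀ᵐ t ∂μ, ψ t = ∑ j, α j * (A j).indicator (fun _ => (1 : ℝ)) t := by
      have h1 : ∀ᵐ t ∂μ, ∀ j, (indicatorConstLp 2 (hA j) (measure_ne_top μ _) (1 : ℝ) : Lp ℝ 2 μ) t
          = (A j).indicator (fun _ => (1 : ℝ)) t :=
        ae_all_iff.2 fun j => indicatorConstLp_coeFn
      have h2 : ∀ᵐ t ∂μ, ∀ j, (α j • indicatorConstLp 2 (hA j) (measure_ne_top μ _) (1 : ℝ) :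
          Lp ℝ 2 μ) t = α j • (indicatorConstLp 2 (hA j) (measure_ne_top μ _) (1 : ℝ) : Lp ℝ 2 μ) t :=
        ae_all_iff.2 fun j => Lp.coeFn_smul _ _
      have h3 := Lp.coeFn_finsetSum (p := 2) (μ := μ) Finset.univ
        (fun j => α j • indicatorConstLp 2 (hA j) (measure_ne_top μ _) (1 : ℝ))
      filter_upwards [h1, h2, h3] with t h1 h2 h3
      rw [hψ, h3]
      simp only [Finset.sum_apply, h2, h1, smul_eq_mul]
    have hbound : ∀ᵐ t ∂μ, (0 ≤ g t + ψ t ∧ g t + ψ t ≤ 1) ∧ (0 ≤ g t - ψ t ∧ g t - ψ t ≤ 1) := by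
      filter_upwards [hψc, hg.1] with t ht hgt
      by_cases hex : ∃ j, t ∈ A j
      · obtain ⟨j, hj⟩ := hex
        have e : ψ t = α j := by
          rw [ht, Finset.sum_eq_single j]
          · simp [hj]
          · intro k _ hkj
            have : t ∉ A k := fun hk => Set.disjoint_left.1 (hAd k j hkj) hk hj
            simp [this]
          · simp
        have h1 := hAE j hj
        have h2 := abs_le.1 (hαε j)
        simp only [Set.mem_ofPred_eq] at h1
        rw [e]
        refine ⟨⟨?_, ?_⟩, ?_, ?_⟩ <;> linarith
      · push Not at hex
        have e : ψ t = 0 := by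
          rw [ht]; exact Finset.sum_eq_zero fun j _ => by simp [hex j]
        simp [e, hgt]
    have hin : ∀ i, inner ℝ ψ (h i) = 0 := by
      intro i
      rw [hψ, sum_inner]
      simp only [real_inner_smul_left, ind]
      exact hα i
    have hz : ψ = 0 := by
      refine hext ψ ⟨?_, fun i => ?_⟩ ⟨?_, fun i => ?_⟩
      · filter_upwards [hbound, Lp.coeFn_add g ψ] with t h1 h2
        rw [h2]; exact h1.1
      · rw [inner_add_left, hin, hg.2, add_zero]
      · filter_upwards [hbound, Lp.coeFn_sub g ψ] with t h1 h2
        rw [h2]; exact h1.2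
      · rw [inner_sub_left, hin, hg.2, sub_zero]
    have h0 : ∀ᵐ t ∂μ, t ∉ A j₀ := by
      have hz' : ∀ᵐ t ∂μ, ψ t = 0 := by rw [hz]; exact Lp.coeFn_zero ..
      filter_upwards [hψc, hz'] with t h1 h2 hj
      rw [h2, Finset.sum_eq_single j₀] at h1
      · simp [hj] at h1
        exact hj₀ h1.symm
      · intro k _ hkj
        have : t ∉ A k := fun hk => Set.disjoint_left.1 (hAd k j₀ hkj) hk hj
        simp [this]
      · simp
    have := measure_eq_zero_iff_ae_notMem.2 h0
    exact (hA0 j₀).ne' this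
  have h01 : ∀ᵐ t ∂μ, g t = 0 ∨ g t = 1 := by
    have h1 : ∀ᵐ t ∂μ, ∀ k : ℕ, ¬ (1 / ((k : ℝ) + 1) ≤ g t ∧ g t ≤ 1 - 1 / ((k : ℝ) + 1)) :=
      ae_all_iff.2 fun k => measure_eq_zero_iff_ae_notMem.1 (key _ (by positivity))
    filter_upwards [h1, hg.1] with t ht hgt
    by_contra hcon
    push Not at hcon
    have ha : 0 < min (g t) (1 - g t) := lt_min (lt_of_le_of_ne hgt.1 hcon.1.symm)
      (sub_pos.2 (lt_of_le_of_ne hgt.2 hcon.2))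
    obtain ⟨k, hk⟩ := exists_nat_one_div_lt ha
    have h2 := lt_min_iff.1 hk
    exact ht k ⟨h2.1.le, by linarith [h2.2]⟩
  refine ⟨{t | g t = 1}, hgs.measurable (measurableSet_singleton 1), fun i => ?_⟩
  have hE : MeasurableSet {t | g t = 1} := hgs.measurable (measurableSet_singleton 1)
  rw [← ind _ hE (h i), show s * ∫ t, h i t ∂μ = c i from rfl, ← hg.2 i]
  congr 1
  refine Lp.ext ?_
  filter_upwards [indicatorConstLp_coeFn (p := 2) (μ := μ) (hs := hE)
    (hμs := measure_ne_top μ _) (c := (1 : ℝ)), h01] with t h1 h2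
  rw [h1]
  rcases h2 with h2 | h2 <;> simp [h2, Set.indicator]

/-- **Lyapunov's convexity theorem**, in the form used for integrals of selections. -/
theorem Atomless.exists_setIntegral_eq [IsFiniteMeasure μ] (hμ : Atomless μ) {n : ℕ}
    {h : T → Fin n → ℝ} (hh : Integrable h μ) {s : ℝ} (hs0 : 0 ≤ s) (hs1 : s ≤ 1) :
    ∃ E, MeasurableSet E ∧ ∫ t in E, h t ∂μ = s • ∫ t, h t ∂μ := by
  set k : T → Fin n → ℝ := hh.1.mk h with hk
  have hkm : StronglyMeasurable k := hh.1.stronglyMeasurable_mk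
  have hkh : h =ᵐ[μ] k := hh.1.ae_eq_mk
  have hki : Integrable k μ := hh.congr hkh
  -- Passing to the measure with density `w` makes `k / w` bounded, hence square integrable, and
  -- leaves the integrals unchanged. As `w` is positive, null sets and atomlessness are preserved.
  let w : T → NNReal := fun t => 1 + ‖k t‖₊
  have hw : Measurable w := measurable_const.add hkm.measurable.nnnorm
  have hw0 : ∀ t, w t ≠ 0 := fun t => by positivity
  let ν : Measure T := μ.withDensity fun t => (w t : ENNReal)
  have : IsFiniteMeasure ν := by
    refine isFiniteMeasure_withDensity ?_
    have : ∫⁻ t, (w t : ENNReal) ∂μ = ∫⁻ t, (1 + ‖k t‖ₑ) ∂μ := by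
      refine lintegral_congr fun t => ?_
      simp [w, enorm]
    rw [this, lintegral_add_left measurable_const]
    simp only [lintegral_const, one_mul]
    exact ENNReal.add_ne_top.2 ⟨measure_ne_top _ _, hki.2.ne⟩
  have hνz : ∀ A, MeasurableSet A → (0 < ν A ↔ 0 < μ A) := by
    intro A hA
    have h1 : ν ≪ μ := withDensity_absolutelyContinuous _ _
    have h2 : μ ≪ ν := withDensity_absolutelyContinuous' hw.coe_nnreal_ennreal.aemeasurable
      (Filter.Eventually.of_forall fun t => by simpa using hw0 t)
    rw [pos_iff_ne_zero, pos_iff_ne_zero]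
    exact ⟨fun h3 h4 => h3 (h1 h4), fun h3 h4 => h3 (h2 h4)⟩
  have hν : Atomless ν := by
    intro A hA hpos
    obtain ⟨B, hBA, hB, h1, h2⟩ := hμ A hA ((hνz A hA).1 hpos)
    exact ⟨B, hBA, hB, (hνz B hB).2 h1, (hνz _ (hA.diff hB)).2 h2⟩
  let u : Fin n → T → ℝ := fun i t => (w t : ℝ)⁻¹ * k t i
  have hum : ∀ i, Measurable (u i) := fun i =>
    hw.coe_nnreal_real.inv.mul ((measurable_pi_apply i).comp hkm.measurable)
  have hu : ∀ i, MemLp (u i) 2 ν := by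
    intro i
    refine MemLp.of_bound (hum i).aestronglyMeasurable 1 (Filter.Eventually.of_forall fun t => ?_)
    have h1 : ‖k t i‖ ≤ ‖k t‖ := norm_le_pi_norm _ _
    have h2 : (w t : ℝ) = 1 + ‖k t‖ := by simp [w]
    have h3 : 0 < 1 + ‖k t‖ := by positivity
    simp only [u]
    rw [norm_mul, norm_inv, h2, Real.norm_of_nonneg h3.le, inv_mul_le_iff₀ h3]
    linarith
  obtain ⟨E, hE, hEi⟩ := lyapunov_L2 hν (fun i => (hu i).toLp) hs0 hs1
  have conv : ∀ A, MeasurableSet A → ∀ i, ∫ t in A, ((hu i).toLp (u i) : Lp ℝ 2 ν) t ∂ν = ∫ t in A, k t i ∂μ := by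
    intro A hA i
    rw [integral_congr_ae (ae_restrict_of_ae (hu i).coeFn_toLp)]
    rw [restrict_withDensity hA, integral_withDensity_eq_integral_smul hw]
    refine integral_congr_ae (Filter.Eventually.of_forall fun t => ?_)
    have : (w t : ℝ) ≠ 0 := by exact_mod_cast hw0 t
    simp only [u, NNReal.smul_def, smul_eq_mul]
    field_simp
  refine ⟨E, hE, ?_⟩
  rw [integral_congr_ae (ae_restrict_of_ae hkh), integral_congr_ae hkh]
  ext i
  have ev : ∀ ρ : Measure T, Integrable k ρ → (∫ t, k t ∂ρ) i = ∫ t, k t i ∂ρ := fun ρ hρ =>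
    eval_integral (fun i => (ContinuousLinearMap.proj (R := ℝ) i).integrable_comp hρ) i
  have h1 := hEi i
  rw [conv E hE i] at h1
  have h2 := conv _ MeasurableSet.univ i
  rw [Measure.restrict_univ, Measure.restrict_univ] at h2
  rw [h2] at h1
  rw [Pi.smul_apply, ev _ hki.restrict, ev _ hki, h1, smul_eq_mul]

end Lyapunov

/-! ### Measurable correspondences, maximizers and selections. -/

section LevelCorrespondence

open Filter Topology

variable {T : Type*} [MeasurableSpace T] {n : ℕ}

/-- Functions measurable in the first and continuous in the second variable. -/
structure Caratheodory (ψ : T → (Fin n → ℝ) → ℝ) : Prop where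
  measurable : ∀ x, Measurable fun t => ψ t x
  continuous : ∀ t, Continuous (ψ t)

/-- Correspondences with non-empty values which are the zero sets of a nonnegative Carathéodory
function in the balls of radius `b t`. -/
structure IsLevelCorrespondence (b : T → ℝ) (F : T → Set (Fin n → ℝ)) : Prop where
  measurable_bound : Measurable b
  nonempty : ∀ t, (F t).Nonempty
  exists_eq : ∃ φ : T → (Fin n → ℝ) → ℝ, Caratheodory φ ∧ (∀ t x, 0 ≤ φ t x) ∧
    ∀ t, F t = {x | ‖x‖ ≤ b t ∧ φ t x = 0}

namespace Caratheodory

variable {ψ φ : T → (Fin n → ℝ) → ℝ}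

theorem comp_measurable (hψ : Caratheodory ψ) {g : T → Fin n → ℝ} (hg : Measurable g) :
    Measurable fun t => ψ t (g t) := by
  have := measurable_uncurry_of_continuous_of_measurable (u := fun x t => ψ t x)
    hψ.continuous hψ.measurable
  exact this.comp (hg.prodMk measurable_id)

theorem add (hψ : Caratheodory ψ) (hφ : Caratheodory φ) :
    Caratheodory fun t x => ψ t x + φ t x :=
  ⟨fun x => (hψ.measurable x).add (hφ.measurable x),
    fun t => (hψ.continuous t).add (hφ.continuous t)⟩

theorem deficit (hψ : Caratheodory ψ) {m : T → ℝ} (hm : Measurable m) :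
    Caratheodory fun t x => max (m t - ψ t x) 0 :=
  ⟨fun x => (hm.sub (hψ.measurable x)).max measurable_const,
    fun t => (continuous_const.sub (hψ.continuous t)).max continuous_const⟩

theorem of_continuous {q : (Fin n → ℝ) → ℝ} (hq : Continuous q) :
    Caratheodory fun (_ : T) x => q x :=
  ⟨fun _ => measurable_const, fun _ => hq⟩

/-- By compactness of the ball, a nonnegative continuous function vanishes somewhere on it exactly
when it takes arbitrarily small values on a dense subset. A dense sequence of the unit ball, scaled
by `b t`, serves all `t` at once. -/
theorem measurableSet_exists_zero (hφ : Caratheodory φ) (h0 : ∀ t x, 0 ≤ φ t x) {b : T → ℝ}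
    (hb : Measurable b) (hb0 : ∀ t, 0 ≤ b t) :
    MeasurableSet {t | ∃ x, ‖x‖ ≤ b t ∧ φ t x = 0} := by
  have hne : Nonempty (Metric.closedBall (0 : Fin n → ℝ) 1) := ⟨⟨0, by simp⟩⟩
  let d : ℕ → Metric.closedBall (0 : Fin n → ℝ) 1 := TopologicalSpace.denseSeq _
  have key : {t | ∃ x, ‖x‖ ≤ b t ∧ φ t x = 0} =
      ⋂ k : ℕ, ⋃ j : ℕ, {t | φ t (b t • (d j : Fin n → ℝ)) < 1 / ((k : ℝ) + 1)} := by
    ext t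
    simp only [Set.mem_ofPred_eq, Set.mem_iInter, Set.mem_iUnion]
    constructor
    · rintro ⟨x, hx, hx0⟩ k
      obtain ⟨z, rfl⟩ : ∃ z : Metric.closedBall (0 : Fin n → ℝ) 1, x = b t • (z : Fin n → ℝ) := by
        rcases (hb0 t).eq_or_lt with h | h
        · rw [← h] at hx ⊢
          exact ⟨⟨0, by simp⟩, by simpa using hx⟩
        · refine ⟨⟨(b t)⁻¹ • x, ?_⟩, ?_⟩
          · rw [mem_closedBall_zero_iff, norm_smul, norm_inv, Real.norm_of_nonneg h.le,
              inv_mul_le_iff₀ h, mul_one]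
            exact hx
          · rw [smul_inv_smul₀ h.ne']
      have hc : Continuous fun z : Metric.closedBall (0 : Fin n → ℝ) 1 => φ t (b t • (z : Fin n → ℝ)) :=
        (hφ.continuous t).comp (by fun_prop)
      have hopen := isOpen_Iio.preimage hc (t := Set.Iio (1 / ((k : ℝ) + 1)))
      obtain ⟨_, hz, j, rfl⟩ := (TopologicalSpace.denseRange_denseSeq _).inter_open_nonempty _ hopen
        ⟨z, by simp only [Set.mem_preimage, hx0, Set.mem_Iio]; positivity⟩
      exact ⟨j, hz⟩
    · intro h
      obtain ⟨x, hx, hmin⟩ := (isCompact_closedBall (0 : Fin n → ℝ) (b t)).exists_isMinOn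
        ⟨0, by simpa using hb0 t⟩ (hφ.continuous t).continuousOn
      refine ⟨x, by simpa using hx, le_antisymm ?_ (h0 t x)⟩
      refine le_of_forall_pos_le_add fun ε hε => ?_
      obtain ⟨k, hk⟩ := exists_nat_one_div_lt hε
      obtain ⟨j, hj⟩ := h k
      have : φ t x ≤ φ t (b t • (d j : Fin n → ℝ)) := hmin (by
        rw [mem_closedBall_zero_iff, norm_smul, Real.norm_of_nonneg (hb0 t)]
        exact mul_le_of_le_one_right (hb0 t) (mem_closedBall_zero_iff.1 (d j).2))
      linarith
  rw [key]
  exact MeasurableSet.iInter fun k => MeasurableSet.iUnion fun j =>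
    measurableSet_lt (hφ.comp_measurable (hb.smul measurable_const)) measurable_const

end Caratheodory

namespace IsLevelCorrespondence

variable {b : T → ℝ} {F : T → Set (Fin n → ℝ)} {ψ : T → (Fin n → ℝ) → ℝ}

theorem norm_le (hF : IsLevelCorrespondence b F) {t : T} {x : Fin n → ℝ} (hx : x ∈ F t) :
    ‖x‖ ≤ b t := by
  obtain ⟨φ, -, -, h⟩ := hF.exists_eq
  rw [h] at hx
  exact hx.1

theorem bound_nonneg (hF : IsLevelCorrespondence b F) (t : T) : 0 ≤ b t := by
  obtain ⟨x, hx⟩ := hF.nonempty t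
  exact (norm_nonneg x).trans (hF.norm_le hx)

theorem isCompact (hF : IsLevelCorrespondence b F) (t : T) : IsCompact (F t) := by
  obtain ⟨φ, hφ, -, h⟩ := hF.exists_eq
  have : F t = Metric.closedBall 0 (b t) ∩ {x | φ t x = 0} := by
    rw [h]; ext x; simp
  rw [this]
  exact (isCompact_closedBall _ _).inter_right (isClosed_eq (hφ.continuous t) continuous_const)

/-- The measurable maximum theorem. -/
theorem exists_argmax (hF : IsLevelCorrespondence b F) (hψ : Caratheodory ψ) :
    ∃ m : T → ℝ, Measurable m ∧ (∀ t, ∀ x ∈ F t, ψ t x ≤ m t) ∧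
      IsLevelCorrespondence b fun t => {x ∈ F t | ψ t x = m t} := by
  obtain ⟨φ, hφ, hφ0, hFφ⟩ := id hF.exists_eq
  have hmax : ∀ t, ∃ x ∈ F t, ∀ z ∈ F t, ψ t z ≤ ψ t x := fun t =>
    (hF.isCompact t).exists_isMaxOn (hF.nonempty t) (hψ.continuous t).continuousOn
  choose s hs hsmax using hmax
  -- The choice `s` need not be measurable, but its value is: the maximum is at least `c` exactly
  -- when `φ` and the deficit below `c` vanish together somewhere in the ball.
  have hm : Measurable fun t => ψ t (s t) := by
    refine measurable_of_Ici fun c => ?_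
    convert (hφ.add (hψ.deficit (m := fun _ => c) measurable_const)).measurableSet_exists_zero
      (fun t x => add_nonneg (hφ0 t x) (le_max_right _ _)) hF.measurable_bound hF.bound_nonneg using 1
    ext t
    simp only [Set.mem_preimage, Set.mem_Ici, Set.mem_ofPred_eq]
    constructor
    · intro h
      have h1 := hs t
      rw [hFφ] at h1
      exact ⟨s t, h1.1, by rw [h1.2, max_eq_right (by linarith), add_zero]⟩
    · rintro ⟨x, hx, hx0⟩
      have h1 := hφ0 t x
      have h2 := le_max_right (c - ψ t x) 0
      have h3 := le_max_left (c - ψ t x) 0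
      have : x ∈ F t := by
        rw [hFφ]; exact ⟨hx, by linarith⟩
      have := hsmax t x this
      linarith
  refine ⟨fun t => ψ t (s t), hm, hsmax, hF.measurable_bound, fun t => ⟨s t, hs t, rfl⟩,
    fun t x => φ t x + max (ψ t (s t) - ψ t x) 0, hφ.add (hψ.deficit hm),
    fun t x => add_nonneg (hφ0 t x) (le_max_right _ _), fun t => ?_⟩
  ext x
  simp only [Set.mem_ofPred_eq]
  constructor
  · rintro ⟨hx, h⟩
    rw [hFφ] at hx
    exact ⟨hx.1, by rw [hx.2, h]; simp⟩
  · rintro ⟨hx, h⟩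
    have h1 := hφ0 t x
    have h2 := le_max_right (ψ t (s t) - ψ t x) 0
    have h3 := le_max_left (ψ t (s t) - ψ t x) 0
    have hxF : x ∈ F t := by
      rw [hFφ]; exact ⟨hx, by linarith⟩
    exact ⟨hxF, le_antisymm (hsmax t x hxF) (by linarith)⟩

/-- Measurable selections exist. -/
theorem exists_selection (hF : IsLevelCorrespondence b F) :
    ∃ f : T → Fin n → ℝ, Measurable f ∧ ∀ t, f t ∈ F t := by
  -- Maximizing the coordinates one after another pins each to a measurable function; once all are
  -- pinned, the values are single points.
  have key : ∀ s : Finset (Fin n), ∃ G : T → Set (Fin n → ℝ), IsLevelCorrespondence b G ∧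
      (∀ t, G t ⊆ F t) ∧ ∃ m : Fin n → T → ℝ, ∀ i ∈ s, Measurable (m i) ∧
        ∀ t, ∀ x ∈ G t, x i = m i t := by
    intro s
    induction s using Finset.induction_on with
    | empty => exact ⟨F, hF, fun t => subset_rfl, fun _ _ => 0, by simp⟩
    | insert i s hi ih =>
      obtain ⟨G, hG, hGF, m, hm⟩ := ih
      obtain ⟨v, hv, -, hG'⟩ := hG.exists_argmax
        (Caratheodory.of_continuous (T := T) (continuous_apply i))
      refine ⟨_, hG', fun t x hx => hGF t hx.1, Function.update m i v, fun j hj => ?_⟩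
      by_cases hji : j = i
      · subst hji
        rw [Function.update_self]
        exact ⟨hv, fun t x hx => hx.2⟩
      · rw [Function.update_of_ne hji]
        obtain ⟨h1, h2⟩ := hm j ((Finset.mem_insert.1 hj).resolve_left hji)
        exact ⟨h1, fun t x hx => h2 t x hx.1⟩
  obtain ⟨G, hG, hGF, m, hm⟩ := key Finset.univ
  refine ⟨fun t i => m i t, measurable_pi_lambda _ fun i => (hm i (Finset.mem_univ i)).1,
    fun t => hGF t ?_⟩
  obtain ⟨x, hx⟩ := hG.nonempty t
  convert hx using 1
  ext i
  exact ((hm i (Finset.mem_univ i)).2 t x hx).symm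

/-- Measurable nearest-point selections exist. -/
theorem exists_nearest_selection (hF : IsLevelCorrespondence b F) {f : T → Fin n → ℝ}
    (hf : Measurable f) :
    ∃ g : T → Fin n → ℝ, Measurable g ∧ (∀ t, g t ∈ F t) ∧
      ∀ t, ∀ x ∈ F t, ‖g t - f t‖ ≤ ‖x - f t‖ := by
  have hψ : Caratheodory fun t x => -‖x - f t‖ :=
    ⟨fun x => (measurable_const.sub hf).norm.neg,
      fun t => (continuous_id.sub continuous_const).norm.neg⟩
  obtain ⟨m, -, hmax, hG⟩ := hF.exists_argmax hψ
  obtain ⟨g, hg, hgG⟩ := hG.exists_selection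
  refine ⟨g, hg, fun t => (hgG t).1, fun t x hx => ?_⟩
  have h1 := hmax t x hx
  have h2 := (hgG t).2
  linarith

variable {μ : Measure T}

theorem ae_norm_le (hF : IsLevelCorrespondence b F) {f : T → Fin n → ℝ}
    (hfF : ∀ᵐ t ∂μ, f t ∈ F t) : ∀ᵐ t ∂μ, ‖f t‖ ≤ b t :=
  hfF.mono fun _ ht => hF.norm_le ht

theorem integrable_selection (hF : IsLevelCorrespondence b F) (hb : Integrable b μ)
    {f : T → Fin n → ℝ} (hf : Measurable f) (hfF : ∀ᵐ t ∂μ, f t ∈ F t) : Integrable f μ :=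
  hb.mono' hf.aestronglyMeasurable (hF.ae_norm_le hfF)

theorem aumannIntegral_nonempty (hF : IsLevelCorrespondence b F) (hb : Integrable b μ) :
    (aumannIntegral μ F).Nonempty := by
  obtain ⟨f, hf, hfF⟩ := hF.exists_selection
  exact ⟨_, f, hF.integrable_selection hb hf (.of_forall hfF), .of_forall hfF, rfl⟩

end IsLevelCorrespondence

theorem exists_measurable_of_mem_aumannIntegral {μ : Measure T} {F : T → Set (Fin n → ℝ)}
    {y : Fin n → ℝ} (hy : y ∈ aumannIntegral μ F) :
    ∃ f : T → Fin n → ℝ, Measurable f ∧ Integrable f μ ∧ (∀ᵐ t ∂μ, f t ∈ F t) ∧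
      y = ∫ t, f t ∂μ := by
  obtain ⟨f, hf, hfF, rfl⟩ := hy
  have h := hf.1.ae_eq_mk
  refine ⟨hf.1.mk f, hf.1.stronglyMeasurable_mk.measurable, hf.congr h, ?_, integral_congr_ae h⟩
  filter_upwards [h, hfF] with t h1 h2
  rwa [← h1]

end LevelCorrespondence

/-! ### Weak separation in finite dimension. -/

section Separation

variable {W : Type*} [NormedAddCommGroup W] [NormedSpace ℝ W] [FiniteDimensional ℝ W]

/-- With non-empty interior this is Hahn–Banach followed by closure. Otherwise the set spans a
proper affine subspace, so some nonzero functional is constant on it, and its sign can be chosen. -/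
theorem exists_ne_zero_forall_le_zero {C : Set W} (hC : Convex ℝ C) (hne : C.Nonempty)
    (h0 : (0 : W) ∉ C) : ∃ q : W →ₗ[ℝ] ℝ, q ≠ 0 ∧ ∀ x ∈ C, q x ≤ 0 := by
  by_cases hint : (interior C).Nonempty
  · obtain ⟨f, hf⟩ := geometric_hahn_banach_open_point hC.interior isOpen_interior
      (fun h => h0 (interior_subset h))
    rw [map_zero] at hf
    refine ⟨f.toLinearMap, ?_, ?_⟩
    · rintro h
      obtain ⟨a, ha⟩ := hint
      have h1 := hf a ha
      have h2 := LinearMap.congr_fun h a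
      simp at h2
      linarith
    · intro x hx
      have h1 : x ∈ closure (interior C) := by
        rw [hC.closure_interior_eq_closure_of_nonempty_interior hint]
        exact subset_closure hx
      exact closure_minimal (fun a ha => (hf a ha).le)
        (isClosed_le f.continuous continuous_const) h1
  · rw [hC.interior_nonempty_iff_affineSpan_eq_top,
      AffineSubspace.affineSpan_eq_top_iff_vectorSpan_eq_top_of_nonempty ℝ W W hne] at hint
    obtain ⟨q, hq, hle⟩ := Submodule.exists_le_ker_of_lt_top _ (lt_top_iff_ne_top.2 hint)
    obtain ⟨z, hz⟩ := hne
    have hconst : ∀ x ∈ C, q x = q z := fun x hx => by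
      have := hle (vsub_mem_vectorSpan ℝ hx hz)
      rw [LinearMap.mem_ker, vsub_eq_sub, map_sub, sub_eq_zero] at this
      exact this
    rcases le_total (q z) 0 with h | h
    · exact ⟨q, hq, fun x hx => (hconst x hx).trans_le h⟩
    · refine ⟨-q, neg_ne_zero.2 hq, fun x hx => ?_⟩
      rw [LinearMap.neg_apply, hconst x hx]
      linarith

end Separation

/-! ### Aumann integrals: faces and the atomless case. -/

section AumannIntegral

open Filter Topology

variable {T : Type*} [MeasurableSpace T] {n : ℕ} {μ : Measure T} {b : T → ℝ}
  {F : T → Set (Fin n → ℝ)}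

/-- Lyapunov's theorem for `f - g` gives a set `E` such that using `f` on `E` and `g` elsewhere
realizes the convex combination. -/
theorem Atomless.convex_aumannIntegral [IsFiniteMeasure μ] (hμ : Atomless μ) :
    Convex ℝ (aumannIntegral μ F) := by
  rintro _ ⟨f, hf, hfF, rfl⟩ _ ⟨g, hg, hgF, rfl⟩ s r hs hr hsr
  obtain ⟨E, hE, h⟩ := hμ.exists_setIntegral_eq (hf.sub hg) hs (by linarith)
  classical
  refine ⟨E.piecewise f g, Integrable.piecewise hE hf.integrableOn hg.integrableOn, ?_, ?_⟩
  · filter_upwards [hfF, hgF] with t h1 h2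
    by_cases ht : t ∈ E <;> simp [ht, h1, h2]
  · rw [integral_piecewise hE hf.integrableOn hg.integrableOn]
    simp only [Pi.sub_apply] at h
    rw [integral_sub hf.restrict hg.restrict, integral_sub hf hg] at h
    rw [eq_sub_of_add_eq' (integral_add_compl hE hg), sub_eq_iff_eq_add.1 h,
      eq_sub_of_add_eq' hsr]
    module

/-- Every subsequential limit of `u` lies in the level set `q = m` of `K`, so it competes with the
nearest point `g i`, and its own distance to `u i` tends to zero. -/
theorem tendsto_norm_sub_of_argmax {K : Set (Fin n → ℝ)} (hK : IsCompact K)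
    {q : (Fin n → ℝ) → ℝ} (hq : Continuous q) {m : ℝ} {u g : ℕ → Fin n → ℝ} (hu : ∀ i, u i ∈ K)
    (hum : Tendsto (fun i => q (u i)) atTop (𝓝 m))
    (hg : ∀ i, ∀ x ∈ K, q x = m → ‖g i - u i‖ ≤ ‖x - u i‖) :
    Tendsto (fun i => g i - u i) atTop (𝓝 0) := by
  refine tendsto_of_subseq_tendsto fun ns hns => ?_
  obtain ⟨x, hx, φ, hφ, hlim⟩ := hK.tendsto_subseq (fun i => hu (ns i))
  have hqx : q x = m := tendsto_nhds_unique ((hq.tendsto x).comp hlim)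
    (hum.comp (hns.comp hφ.tendsto_atTop))
  refine ⟨φ, squeeze_zero_norm (fun i => hg (ns (φ i)) x hx hqx) ?_⟩
  simpa using (tendsto_const_nhds (x := x)).sub hlim |>.norm

/-- A boundary point of an Aumann integral is approximated by integrals of selections of the
corresponding face. -/
theorem IsLevelCorrespondence.mem_closure_face [IsFiniteMeasure μ]
    (hF : IsLevelCorrespondence b F) (hb : Integrable b μ) (q : (Fin n → ℝ) →L[ℝ] ℝ)
    {y : Fin n → ℝ} (hy : y ∈ closure (aumannIntegral μ F))
    (hq : ∀ x ∈ aumannIntegral μ F, q x ≤ q y) :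
    ∃ G : T → Set (Fin n → ℝ), IsLevelCorrespondence b G ∧ (∀ t, G t ⊆ F t) ∧
      y ∈ closure (aumannIntegral μ G) ∧ ∀ x ∈ aumannIntegral μ G, q x = q y := by
  obtain ⟨m, hm, hmax, hG⟩ := hF.exists_argmax (Caratheodory.of_continuous (T := T) q.continuous)
  have hGm : ∀ f : T → Fin n → ℝ, Integrable f μ → (∀ᵐ t ∂μ, f t ∈ {x ∈ F t | q x = m t}) →
      q (∫ t, f t ∂μ) = ∫ t, m t ∂μ := by
    intro f hf hfG
    rw [← q.integral_comp_comm hf]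
    exact integral_congr_ae (hfG.mono fun t ht => ht.2)
  have hmi : Integrable m μ := by
    obtain ⟨f, hf, hfG⟩ := hG.exists_selection
    refine (q.integrable_comp (hG.integrable_selection hb hf (.of_forall hfG))).congr ?_
    exact .of_forall fun t => (hfG t).2
  have hFm : ∀ x ∈ aumannIntegral μ F, q x ≤ ∫ t, m t ∂μ := by
    rintro _ ⟨f, hf, hfF, rfl⟩
    rw [← q.integral_comp_comm hf]
    exact integral_mono_ae (q.integrable_comp hf) hmi (hfF.mono fun t ht => hmax t _ ht)
  have hym : q y = ∫ t, m t ∂μ := by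
    refine le_antisymm (closure_minimal hFm (isClosed_le q.continuous continuous_const) hy) ?_
    obtain ⟨f, hf, hfG⟩ := hG.exists_selection
    have hfi := hG.integrable_selection (μ := μ) hb hf (.of_forall hfG)
    rw [← hGm f hfi (.of_forall hfG)]
    exact hq _ ⟨f, hfi, .of_forall fun t => (hfG t).1, rfl⟩
  refine ⟨_, hG, fun t x hx => hx.1, ?_, ?_⟩
  swap
  · rintro _ ⟨f, hf, hfG, rfl⟩
    rw [hGm f hf hfG, hym]
  obtain ⟨x, hx, hxy⟩ := mem_closure_iff_seq_limit.1 hy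
  choose f hf hfi hfF hxf using fun i => exists_measurable_of_mem_aumannIntegral (hx i)
  choose g hg hgG hgmin using fun i => hG.exists_nearest_selection (hf i)
  have hgi : ∀ i, Integrable (g i) μ := fun i =>
    hG.integrable_selection hb (hg i) (.of_forall (hgG i))
  -- Since `q (f i t) ≤ m t` almost everywhere, the L¹ distance is just the difference of the
  -- integrals, `q y - q (x i)`.
  have hmeas : TendstoInMeasure μ (fun i t => q (f i t)) atTop m := by
    refine tendstoInMeasure_of_tendsto_eLpNorm (p := 1) one_ne_zero
      (fun i => (q.integrable_comp (hfi i)).1) hmi.1 ?_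
    have e : ∀ i, eLpNorm ((fun t => q (f i t)) - m) 1 μ = ENNReal.ofReal (q y - q (x i)) := by
      intro i
      rw [eLpNorm_one_eq_lintegral_enorm,
        ← ofReal_integral_norm_eq_lintegral_enorm ((q.integrable_comp (hfi i)).sub hmi), hxf i,
        ← q.integral_comp_comm (hfi i), hym, ← integral_sub hmi (q.integrable_comp (hfi i))]
      congr 1
      refine integral_congr_ae ?_
      filter_upwards [hfF i] with t ht
      have := hmax t _ ht
      rw [Pi.sub_apply, Real.norm_eq_abs, abs_sub_comm, abs_of_nonneg (by linarith)]
    simp only [e]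
    have : Tendsto (fun i => q y - q (x i)) atTop (𝓝 (q y - q y)) :=
      tendsto_const_nhds.sub ((q.continuous.tendsto y).comp hxy)
    rw [sub_self] at this
    simpa using ENNReal.tendsto_ofReal this
  obtain ⟨ns, hns, hae⟩ := hmeas.exists_seq_tendsto_ae
  have hdiff : Tendsto (fun i => ∫ t, (g (ns i) t - f (ns i) t) ∂μ) atTop (𝓝 (∫ _, 0 ∂μ)) := by
    refine tendsto_integral_of_dominated_convergence (fun t => b t + b t)
      (fun i => ((hgi _).sub (hfi _)).1) (hb.add hb) (fun i => ?_) ?_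
    · filter_upwards [hfF (ns i)] with t ht
      exact (norm_sub_le _ _).trans (add_le_add (hG.norm_le (hgG _ t)) (hF.norm_le ht))
    · filter_upwards [hae, ae_all_iff.2 hfF] with t h1 h2
      exact tendsto_norm_sub_of_argmax (hF.isCompact t) q.continuous (fun i => h2 (ns i)) h1
        fun i z hz hzm => hgmin (ns i) t z ⟨hz, hzm⟩
  refine mem_closure_of_tendsto (f := fun i => ∫ t, g (ns i) t ∂μ) (b := atTop) ?_
    (.of_forall fun i => ⟨g (ns i), hgi _, .of_forall (hgG _), rfl⟩)
  have e : ∀ i, ∫ t, g (ns i) t ∂μ = (∫ t, (g (ns i) t - f (ns i) t) ∂μ) + x (ns i) := by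
    intro i
    rw [integral_sub (hgi _) (hfi _), hxf (ns i), sub_add_cancel]
  simp only [e]
  simpa using hdiff.add (hxy.comp hns.tendsto_atTop)

/-- Induction on the dimension of a subspace containing all differences from `y`. A functional
supporting the integral at `y` is nonzero on `W`, so passing to its face replaces `W` by a proper
subspace. -/
theorem Atomless.mem_aumannIntegral_of_mem_closure [IsFiniteMeasure μ] (hμ : Atomless μ)
    (hb : Integrable b μ) {y : Fin n → ℝ} (k : ℕ) : ∀ (W : Submodule ℝ (Fin n → ℝ)),
    Module.finrank ℝ W ≤ k → ∀ {F : T → Set (Fin n → ℝ)}, IsLevelCorrespondence b F →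
    y ∈ closure (aumannIntegral μ F) → (∀ x ∈ aumannIntegral μ F, x - y ∈ W) →
    y ∈ aumannIntegral μ F := by
  induction k with
  | zero =>
    intro W hW F hF hy hFW
    obtain ⟨x, hx⟩ := hF.aumannIntegral_nonempty hb
    have h1 := hFW x hx
    rw [Submodule.finrank_eq_zero.1 (Nat.le_zero.1 hW), Submodule.mem_bot, sub_eq_zero] at h1
    rwa [← h1]
  | succ k ih =>
    intro W hW F hF hy hFW
    by_contra hcon
    let C : Set W := {w | y + (w : Fin n → ℝ) ∈ aumannIntegral μ F}
    have hC : Convex ℝ C := by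
      have := (hμ.convex_aumannIntegral (F := F)).translate_preimage_right y
      exact (this.linear_preimage W.subtype :)
    have hCmem : ∀ x (hx : x ∈ aumannIntegral μ F), (⟨x - y, hFW x hx⟩ : W) ∈ C := by
      intro x hx
      simpa [C] using hx
    obtain ⟨x₀, hx₀⟩ := hF.aumannIntegral_nonempty hb
    obtain ⟨q, hq0, hq⟩ := exists_ne_zero_forall_le_zero hC ⟨_, hCmem x₀ hx₀⟩
      (fun h => hcon (by simpa [C] using h))
    obtain ⟨q', hq'⟩ := LinearMap.exists_extend q
    have hq'W : ∀ w : W, q' w = q w := fun w => LinearMap.congr_fun hq' w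
    obtain ⟨G, hG, hGF, hyG, hGq⟩ := hF.mem_closure_face hb (LinearMap.toContinuousLinearMap q') hy
      (by
        intro x hx
        have h1 := hq _ (hCmem x hx)
        rw [← hq'W, map_sub] at h1
        simpa using h1)
    have hGF' : aumannIntegral μ G ⊆ aumannIntegral μ F := by
      rintro _ ⟨f, hf, hfG, rfl⟩
      exact ⟨f, hf, hfG.mono fun t ht => hGF t ht, rfl⟩
    refine hcon (hGF' (ih (W ⊓ LinearMap.ker q') ?_ hG hyG fun x hx => ⟨hFW x (hGF' hx), ?_⟩))
    · have hlt : W ⊓ LinearMap.ker q' < W := by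
        refine lt_of_le_of_ne inf_le_left fun h => hq0 (LinearMap.ext fun w => ?_)
        have : (w : Fin n → ℝ) ∈ W ⊓ LinearMap.ker q' := by rw [h]; exact w.2
        rw [← hq'W]
        exact this.2
      have := Submodule.finrank_lt_finrank_of_lt hlt
      omega
    · have := hGq x hx
      simp only [LinearMap.coe_toContinuousLinearMap'] at this
      simp [this]

end AumannIntegral

/-! ### Splitting off the atoms; closedness and compactness. -/

section Atoms

open Filter Topology

variable {T : Type*} [MeasurableSpace T] {n : ℕ} {μ : Measure T} {b : T → ℝ}
  {F : T → Set (Fin n → ℝ)}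

/-- Measurable sets that do not split into two measurable sets of positive measure: atoms and null
sets. -/
def Indivisible (μ : Measure T) (A : Set T) : Prop :=
  MeasurableSet A ∧ ∀ B ⊆ A, MeasurableSet B → μ B = 0 ∨ μ (A \ B) = 0

/-- Exhaustion: countable unions of indivisible sets attain their supremal measure, and an
unsplittable non-null piece outside a maximal union could be added to it. -/
theorem exists_indivisible_atomless (μ : Measure T) [IsFiniteMeasure μ] :
    ∃ A : ℕ → Set T, (∀ k, Indivisible μ (A k)) ∧ Atomless (μ.restrict (⋃ k, A k)ᶜ) := by
  let S : Set ENNReal := {r | ∃ A : ℕ → Set T, (∀ k, Indivisible μ (A k)) ∧ r = μ (⋃ k, A k)}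
  have hS : S.Nonempty := ⟨_, fun _ => ∅, fun _ => ⟨.empty, fun B hB _ => .inl (by
    rw [Set.subset_empty_iff.1 hB, measure_empty])⟩, rfl⟩
  obtain ⟨u, -, hu, huS⟩ := exists_seq_tendsto_sSup hS (OrderTop.bddAbove _)
  choose A hA hAu using huS
  -- A maximizing sequence of countable families is merged into a single one.
  let M : ℕ → Set T := fun k => A k.unpair.1 k.unpair.2
  have hM : ∀ k, Indivisible μ (M k) := fun k => hA _ _
  have hMle : sSup S ≤ μ (⋃ k, M k) := by
    refine le_of_tendsto' hu fun i => ?_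
    rw [hAu i]
    refine measure_mono (Set.iUnion_subset fun j => ?_)
    refine Set.subset_iUnion_of_subset (Nat.pair i j) ?_
    simp [M]
  have hMm : MeasurableSet (⋃ k, M k) := MeasurableSet.iUnion fun k => (hM k).1
  refine ⟨M, hM, fun E hE hpos => ?_⟩
  by_contra hcon
  push Not at hcon
  rw [Measure.restrict_apply hE] at hpos
  have hE' : MeasurableSet (E ∩ (⋃ k, M k)ᶜ) := hE.inter hMm.compl
  have hind : Indivisible μ (E ∩ (⋃ k, M k)ᶜ) := by
    refine ⟨hE', fun B hB hBm => ?_⟩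
    rcases eq_or_ne (μ B) 0 with h | h
    · exact .inl h
    · right
      have hBM : B ⊆ (⋃ k, M k)ᶜ := hB.trans Set.inter_subset_right
      have h1 := hcon B (hB.trans Set.inter_subset_left) hBm (by
        rw [Measure.restrict_apply hBm, Set.inter_eq_left.2 hBM]
        exact pos_iff_ne_zero.2 h)
      rw [Measure.restrict_apply (hE.diff hBm)] at h1
      refine measure_mono_null ?_ (nonpos_iff_eq_zero.1 h1)
      rintro t ⟨⟨h1, h2⟩, h3⟩
      exact ⟨⟨h1, h3⟩, h2⟩
  let N : ℕ → Set T := fun k => k.casesOn (E ∩ (⋃ k, M k)ᶜ) M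
  have hN : ∀ k, Indivisible μ (N k) := by
    rintro (_ | k)
    · exact hind
    · exact hM k
  have hNM : (⋃ k, M k) ∪ (E ∩ (⋃ k, M k)ᶜ) ⊆ ⋃ k, N k := by
    refine Set.union_subset (Set.iUnion_subset fun k => ?_) ?_
    · exact Set.subset_iUnion N (k + 1)
    · exact Set.subset_iUnion N 0
  have h1 : μ (⋃ k, N k) ≤ sSup S := le_sSup ⟨N, hN, rfl⟩
  have h2 := measure_mono (μ := μ) hNM
  rw [measure_union (Set.disjoint_left.2 fun t ht ht' => ht'.2 ht) hE'] at h2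
  have h3 := ENNReal.lt_add_right (measure_ne_top μ (⋃ k, M k)) hpos.ne'
  exact absurd (h2.trans (h1.trans hMle)) (not_le.2 h3)

/-- On `A` every preimage is null or conull, and countably many measurable sets separate the values.
-/
theorem Indivisible.exists_ae_eq_const {β : Type*} [MeasurableSpace β] [Nonempty β]
    [MeasurableSpace.CountablySeparated β] {A : Set T} (hA : Indivisible μ A) {f : T → β}
    (hf : Measurable f) : ∃ c, ∀ᵐ t ∂μ.restrict A, f t = c := by
  refine Filter.exists_eventuallyEq_const_of_forall_separating MeasurableSet fun U hU => ?_
  rw [ae_restrict_iff' hA.1, ae_restrict_iff' hA.1]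
  rcases hA.2 (A ∩ f ⁻¹' U) Set.inter_subset_left (hA.1.inter (hf hU)) with h | h
  · right
    filter_upwards [measure_eq_zero_iff_ae_notMem.1 h] with t ht htA htU
    exact ht ⟨htA, htU⟩
  · left
    filter_upwards [measure_eq_zero_iff_ae_notMem.1 h] with t ht htA
    by_contra htU
    exact ht ⟨htA, fun h => htU h.2⟩

/-- Measurable functions dominated by a common function have a subsequence which converges almost
everywhere on a countable union of atoms. -/
theorem exists_subseq_tendsto_of_indivisible {A : ℕ → Set T} (hA : ∀ k, Indivisible μ (A k))
    (hb : Measurable b) {f : ℕ → T → Fin n → ℝ} (hf : ∀ i, Measurable (f i))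
    (hfb : ∀ i, ∀ᵐ t ∂μ, ‖f i t‖ ≤ b t) :
    ∃ φ : ℕ → ℕ, StrictMono φ ∧ ∀ᵐ t ∂μ.restrict (⋃ k, A k),
      ∃ l, Tendsto (fun i => f (φ i) t) atTop (𝓝 l) := by
  choose R hR using fun k => (hA k).exists_ae_eq_const hb
  have hc : ∀ i k, ∃ c : Fin n → ℝ, ‖c‖ ≤ |R k| ∧ ∀ᵐ t ∂μ.restrict (A k), f i t = c := by
    intro i k
    obtain ⟨c, hc⟩ := (hA k).exists_ae_eq_const (hf i)
    -- On a null `A k` any constant works; taking 0 keeps it within the bound.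
    rcases eq_or_neBot (ae (μ.restrict (A k))) with h | h
    · exact ⟨0, by simp, by rw [h]; exact Filter.eventually_bot⟩
    · obtain ⟨t, h1, h2, h3⟩ := (hc.and ((hR k).and (ae_restrict_of_ae (hfb i)))).exists
      refine ⟨c, ?_, hc⟩
      rw [← h1, ← h2]
      exact h3.trans (le_abs_self _)
  choose c hcR hcf using hc
  -- Sequential compactness of a countable product of balls replaces a diagonal argument.
  obtain ⟨l, -, φ, hφ, hl⟩ := (isCompact_univ_pi fun k =>
    isCompact_closedBall (0 : Fin n → ℝ) |R k|).tendsto_subseq (x := c)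
    (fun i k _ => by simpa using hcR i k)
  refine ⟨φ, hφ, ?_⟩
  rw [ae_restrict_iUnion_iff]
  intro k
  filter_upwards [ae_all_iff.2 fun i => hcf i k] with t ht
  refine ⟨l k, ?_⟩
  simp only [ht]
  exact ((continuous_apply k).tendsto l).comp hl

theorem IsLevelCorrespondence.isClosed_aumannIntegral [IsFiniteMeasure μ]
    (hF : IsLevelCorrespondence b F) (hb : Integrable b μ) : IsClosed (aumannIntegral μ F) := by
  refine isClosed_of_closure_subset fun y hy => ?_
  obtain ⟨x, hx, hxy⟩ := mem_closure_iff_seq_limit.1 hy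
  choose f hf hfi hfF hxf using fun i => exists_measurable_of_mem_aumannIntegral (hx i)
  obtain ⟨A, hA, hμ⟩ := exists_indivisible_atomless μ
  obtain ⟨φ, hφ, hlim⟩ := exists_subseq_tendsto_of_indivisible hA hF.measurable_bound hf
    fun i => hF.ae_norm_le (hfF i)
  set M : Set T := ⋃ k, A k
  have hM : MeasurableSet M := MeasurableSet.iUnion fun k => (hA k).1
  obtain ⟨u, hu, hfu⟩ := measurable_limit_of_tendsto_metrizable_ae
    (fun i => (hf (φ i)).aemeasurable) hlim
  have huF : ∀ᵐ t ∂μ.restrict M, u t ∈ F t := by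
    filter_upwards [hfu, ae_restrict_of_ae (ae_all_iff.2 hfF)] with t h1 h2
    exact (hF.isCompact t).isClosed.mem_of_tendsto h1 (.of_forall fun i => h2 (φ i))
  have hui : Integrable u (μ.restrict M) := hF.integrable_selection hb.restrict hu huF
  have hMlim : Tendsto (fun i => ∫ t in M, f (φ i) t ∂μ) atTop (𝓝 (∫ t in M, u t ∂μ)) :=
    tendsto_integral_of_dominated_convergence b (fun i => (hfi _).restrict.1) hb.restrict
      (fun i => ae_restrict_of_ae (hF.ae_norm_le (hfF _))) hfu
  have hclos : y - ∫ t in M, u t ∂μ ∈ closure (aumannIntegral (μ.restrict Mᶜ) F) := by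
    refine mem_closure_of_tendsto (f := fun i => ∫ t in Mᶜ, f (φ i) t ∂μ) (b := atTop) ?_
      (.of_forall fun i => ⟨f (φ i), (hfi _).restrict, ae_restrict_of_ae (hfF _), rfl⟩)
    have e : ∀ i, ∫ t in Mᶜ, f (φ i) t ∂μ = x (φ i) - ∫ t in M, f (φ i) t ∂μ := fun i => by
      rw [hxf, ← integral_add_compl hM (hfi _), add_sub_cancel_left]
    simp only [e]
    exact (hxy.comp hφ.tendsto_atTop).sub hMlim
  obtain ⟨g, hg, hgF, hgy⟩ := hμ.mem_aumannIntegral_of_mem_closure hb.restrict _ ⊤ le_rfl hF hclos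
    fun _ _ => Submodule.mem_top
  classical
  refine ⟨M.piecewise u g, Integrable.piecewise hM hui hg, ?_, ?_⟩
  · rw [ae_restrict_iff' hM] at huF
    rw [ae_restrict_iff' hM.compl] at hgF
    filter_upwards [huF, hgF] with t h1 h2
    by_cases ht : t ∈ M
    · simpa [ht] using h1 ht
    · simpa [ht] using h2 ht
  · rw [integral_piecewise hM hui hg, ← hgy]
    abel

/-- The Aumann integral of a measurable, compact-valued, integrably bounded correspondence is
compact. -/
theorem IsLevelCorrespondence.isCompact_aumannIntegral [IsFiniteMeasure μ]
    (hF : IsLevelCorrespondence b F) (hb : Integrable b μ) : IsCompact (aumannIntegral μ F) := by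
  refine (isCompact_closedBall (0 : Fin n → ℝ) (∫ t, b t ∂μ)).of_isClosed_subset
    (hF.isClosed_aumannIntegral hb) ?_
  rintro _ ⟨f, -, hfF, rfl⟩
  rw [mem_closedBall_zero_iff]
  exact norm_integral_le_of_norm_le hb (hF.ae_norm_le hfF)

end Atoms

/-! ### The preferred sets as level correspondences. -/

section Economy

variable {T Ω : Type*} {ℓ : ℕ} {a : T → Ω → Fin ℓ → ℝ} {U : T → Ω → (Fin ℓ → ℝ) → ℝ}

/-- The distance from the orthant in the sum norm. -/
def negativePart (x : Fin ℓ → ℝ) : ℝ := ∑ i, max (-x i) 0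

theorem negativePart_nonneg (x : Fin ℓ → ℝ) : 0 ≤ negativePart x :=
  Finset.sum_nonneg fun _ _ => le_max_right _ _

theorem negativePart_eq_zero {x : Fin ℓ → ℝ} : negativePart x = 0 ↔ x ∈ orthant ℓ := by
  rw [negativePart, Finset.sum_eq_zero_iff_of_nonneg fun _ _ => le_max_right _ _]
  simp [orthant, Pi.le_def]

theorem continuous_negativePart : Continuous (negativePart (ℓ := ℓ)) :=
  continuous_finsetSum _ fun i _ => (continuous_apply i).neg.max continuous_const

/-- The sets of points of `ℝ^ℓ_+` in the ball of radius `b t` where a Carathéodory function is at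
least `m t` form a level correspondence. -/
theorem isLevelCorrespondence_superlevel [MeasurableSpace T] {b m : T → ℝ} {ψ : T → (Fin ℓ → ℝ) → ℝ}
    {F : T → Set (Fin ℓ → ℝ)} (hb : Measurable b) (hm : Measurable m) (hψ : Caratheodory ψ)
    (hne : ∀ t, (F t).Nonempty)
    (hF : ∀ t x, x ∈ F t ↔ x ∈ orthant ℓ ∧ ‖x‖ ≤ b t ∧ m t ≤ ψ t x) :
    IsLevelCorrespondence b F := by
  refine ⟨hb, hne, _, (Caratheodory.of_continuous continuous_negativePart).add (hψ.deficit hm),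
    fun t x => add_nonneg (negativePart_nonneg x) (le_max_right _ _), fun t => ?_⟩
  ext x
  rw [hF, Set.mem_ofPred_eq, add_eq_zero_iff_of_nonneg (negativePart_nonneg x) (le_max_right _ _),
    negativePart_eq_zero, max_eq_right_iff, sub_nonpos]
  tauto

theorem minPrice_pos {p : Fin ℓ → ℝ} (hp : p ∈ priceSimplex ℓ) : 0 < minPrice p := by
  have : Nonempty (Fin ℓ) := by
    by_contra h
    rw [not_nonempty_iff] at h
    simpa using hp.2
  obtain ⟨i, hi⟩ := exists_eq_ciInf_of_finite (f := p)
  rw [minPrice, ← hi]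
  exact hp.1 i

theorem minPrice_le (p : Fin ℓ → ℝ) (i : Fin ℓ) : minPrice p ≤ p i :=
  ciInf_le (Set.finite_range p).bddBelow i

theorem le_upperBound_of_mem_budgetSet {p : Fin ℓ → ℝ} (hp : p ∈ priceSimplex ℓ) {t : T} {ω : Ω}
    (ha : a t ω ∈ orthant ℓ) {x : Fin ℓ → ℝ} (hx : x ∈ budgetSet a t ω p) :
    x ≤ upperBound a t ω p := by
  intro i
  have hδ := minPrice_pos hp
  rw [upperBound, one_div, le_inv_mul_iff₀ hδ]
  have hx0 : ∀ i, 0 ≤ x i := hx.1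
  have ha0 : ∀ i, 0 ≤ a t ω i := ha
  calc minPrice p * x i ≤ p i * x i := mul_le_mul_of_nonneg_right (minPrice_le p i) (hx0 i)
    _ ≤ p ⬝ᵥ x := Finset.single_le_sum (f := fun i => p i * x i)
      (fun i _ => mul_nonneg (hp.1 i).le (hx0 i)) (Finset.mem_univ i)
    _ ≤ p ⬝ᵥ a t ω := hx.2
    _ ≤ ∑ h, a t ω h := Finset.sum_le_sum fun h _ => by
      refine mul_le_of_le_one_left (ha0 h) ?_
      rw [← hp.2]
      exact Finset.single_le_sum (f := p) (fun i _ => (hp.1 i).le) (Finset.mem_univ h)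

/-- The truncation is a norm ball within the orthant and contains the budget set. The maximum
theorem on the budget set makes the indirect utility `m` measurable, and the preferred set is the
part of the truncation where utility is at least `m`. -/
theorem isLevelCorrespondence_preferredSet [MeasurableSpace T] [MeasurableSpace Ω]
    {μ : Measure T} (hA1 : EndowmentAssumption μ a)
    (hA2 : UtilityRegularity U) (ω : Ω) {p : Fin ℓ → ℝ} (hp : p ∈ priceSimplex ℓ) :
    IsLevelCorrespondence (fun t => 1 / minPrice p * ∑ h, a t ω h)
      fun t => preferredSet a U t ω p := by
  set b : T → ℝ := fun t => 1 / minPrice p * ∑ h, a t ω h with hbdef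
  have hδ := minPrice_pos hp
  have hb0 : ∀ t, 0 ≤ b t := fun t =>
    mul_nonneg (by positivity) (Finset.sum_nonneg fun h _ => hA1.mem_orthant t ω h)
  have hbox : ∀ t, ∀ x ∈ orthant ℓ, x ≤ upperBound a t ω p ↔ ‖x‖ ≤ b t := by
    intro t x hx
    rw [pi_norm_le_iff_of_nonneg (hb0 t)]
    exact forall_congr' fun i => by rw [Real.norm_of_nonneg (hx i)]; rfl
  have ham : Measurable fun t => a t ω := hA1.measurable.comp measurable_prodMk_right
  have hah : ∀ h, Measurable fun t => a t ω h := fun h => (measurable_pi_apply h).comp ham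
  have hbm : Measurable b := measurable_const.mul (Finset.measurable_sum _ fun h _ => hah h)
  -- Composing with `x ↦ x ⊔ 0` extends utility from the orthant to a Carathéodory function on the
  -- whole space.
  let ψ : T → (Fin ℓ → ℝ) → ℝ := fun t x => U t ω (x ⊔ 0)
  have hψU : ∀ t, ∀ x ∈ orthant ℓ, ψ t x = U t ω x := fun t x hx => by
    simp only [ψ, sup_eq_left.2 (show 0 ≤ x from hx)]
  have hψ : Caratheodory ψ :=
    ⟨fun x => (hA2.measurable (x ⊔ 0) (show 0 ≤ x ⊔ 0 from le_sup_right)).comp measurable_prodMk_right,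
      fun t => (hA2.continuousOn t ω).comp_continuous
        (continuous_pi fun i => (continuous_apply i).max continuous_const)
        fun x => show 0 ≤ x ⊔ 0 from le_sup_right⟩
  have hB : IsLevelCorrespondence b fun t => budgetSet a t ω p := by
    refine isLevelCorrespondence_superlevel (m := fun t => -(p ⬝ᵥ a t ω)) (ψ := fun _ x => -(p ⬝ᵥ x))
      hbm ?_ (Caratheodory.of_continuous (by simp only [dotProduct]; fun_prop))
      (fun t => ⟨a t ω, hA1.mem_orthant t ω, le_rfl⟩) fun t x => ?_
    · exact (Finset.measurable_sum _ fun h _ => measurable_const.mul (hah h)).neg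
    · rw [neg_le_neg_iff]
      refine ⟨fun h => ⟨h.1, (hbox t x h.1).1 ?_, h.2⟩, fun h => ⟨h.1, h.2.2⟩⟩
      exact le_upperBound_of_mem_budgetSet hp (hA1.mem_orthant t ω) h
  obtain ⟨m, hm, hmax, hG⟩ := hB.exists_argmax hψ
  have hmem : ∀ t x, x ∈ preferredSet a U t ω p ↔ x ∈ orthant ℓ ∧ ‖x‖ ≤ b t ∧ m t ≤ ψ t x := by
    intro t x
    constructor
    · rintro ⟨⟨hx, hxU⟩, -, hxb⟩
      obtain ⟨z, hz, hzm⟩ := hG.nonempty t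
      refine ⟨hx, (hbox t x hx).1 hxb, ?_⟩
      rw [← hzm, hψU t z hz.1, hψU t x hx]
      exact hxU z hz
    · rintro ⟨hx, hxb, hxm⟩
      refine ⟨⟨hx, fun z hz => ?_⟩, hx, (hbox t x hx).2 hxb⟩
      rw [← hψU t z hz.1, ← hψU t x hx]
      exact (hmax t z hz).trans hxm
  refine isLevelCorrespondence_superlevel hbm hm hψ (fun t => ?_) hmem
  obtain ⟨z, hz, hzm⟩ := hG.nonempty t
  exact ⟨z, (hmem t z).2 ⟨hz.1, hB.norm_le hz, hzm.ge⟩⟩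

end Economy

end ExchangeEconomy

theorem mainTheorem5 {T Ω : Type*} [MeasurableSpace T] [MeasurableSpace Ω]
    (μ : Measure T) [IsFiniteMeasure μ] (ℓ : ℕ)
    (a : T → Ω → Fin ℓ → ℝ) (U : T → Ω → (Fin ℓ → ℝ) → ℝ)
    (hA1 : ExchangeEconomy.EndowmentAssumption μ a)
    (hA2 : ExchangeEconomy.UtilityRegularity U)
    (hA3 : ExchangeEconomy.UtilityMonotone U) :
    ∀ (ω : Ω), ∀ p ∈ ExchangeEconomy.priceSimplex ℓ,
      (ExchangeEconomy.aggregatePreferredSet μ a U ω p).Nonempty ∧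
        IsCompact (ExchangeEconomy.aggregatePreferredSet μ a U ω p) := by
  intro ω p hp
  have hF := ExchangeEconomy.isLevelCorrespondence_preferredSet hA1 hA2 ω hp
  have hb : Integrable (fun t => 1 / ExchangeEconomy.minPrice p * ∑ h, a t ω h) μ :=
    (integrable_finsetSum _ fun h _ =>
      (ContinuousLinearMap.proj (R := ℝ) h).integrable_comp (hA1.integrable ω)).const_mul _
  exact ⟨hF.aumannIntegral_nonempty hb, hF.isCompact_aumannIntegral hb⟩
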